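/- Let $D\ge 1$ and let $\mathcal I\subseteq\mathbb R$ be an interval (possibly all of $\mathbb R$). Let $\mathcal F$ be a space of real functions on $\mathcal I$ that is either the space of polynomials of degree smaller than $K$, or the space of real bandlimited functions of some period $\tau>0$, i.e. the span of $1$ and $\cos(2\pi jt/\tau)$, $\sin(2\pi jt/\tau)$ for $1\le j\le B$, where $K=2B+1$. Let $f_0,\dots,f_{K-1}$ be linearly independent functions spanning $\mathcal F$, and write $f(t)=(f_0(t),\dots,f_{K-1}(t))^\top$. Let $a_0,\dots,a_{M-1}\in\mathbb R^D$ be known anchors, any $D+1$ of which are affinely independent. A device moves on a trajectory $r(t)=Cf(t)$ with an unknown matrix $C\in\mathbb R^{D\times K}$. At times $t_0,\dots,t_{N-1}\in\mathcal I$ one measures $d_n=\|a_{m_n}-r(t_n)\|$, where $m_n\in\{0,\dots,M-1\}$ is the index of the anchor used in measurement $n$. Put $b_n=\tfrac12(\|a_{m_n}\|^2-d_n^2)$ and consider the linear system $$b_n=a_{m_n}^\top C'f(t_n)-\tfrac12 f(t_n)^\top L\,f(t_n),\qquad n=0,\dots,N-1,\qquad (\ast)$$ in the unknowns $C'\in\mathbb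 R^{D\times K}$ and $L\in\mathbb R^{K\times K}$, with no relation imposed between $C'$ and $L$. Let $k_m$ be the number of measurements in which the $m$-th anchor is used, and consider the condition $$\sum_{m=0}^{M-1}\min(k_m,K)\ \ge\ K(D+1).\qquad (\ast\ast)$$ 1. Suppose that $N\ge K(D+2)-1$, that $(\ast\ast)$ holds, and that the times $(t_0,\dots,t_{N-1})$ are random with a joint law on $\mathcal I^N$ that is absolutely continuous with respect to Lebesgue measure. Then with probability one the following holds for every $C\in\mathbb R^{D\times K}$: $C$ is the only matrix that produces the measured distances $d_n$, and it is uniquely recovered by $(\ast)$, that is, $(\ast)$ is solvable and every solution $(C',L)$ of $(\ast)$ has $C'=C$. 2. If $(\ast\ast)$ fails, then $(\ast)$ does not determine $C$: for all $N$, all times $t_0,\dots,t_{N-1}\in\mathcal I$ and every $C$, the system $(\ast)$ has a solution $(C',L)$ with $C'\ne C$. -/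

import Mathlib

namespace ContinuousLocalisation

open scoped Matrix

noncomputable section

/-- The space of real polynomial functions of degree smaller than `K`, on the time domain `I`. -/
def polynomialSpace (I : Set ℝ) (K : ℕ) : Submodule ℝ (I → ℝ) :=
  Submodule.span ℝ (Set.range fun (k : Fin K) (t : I) => (t : ℝ) ^ (k : ℕ))

/-- The space of real bandlimited functions of period `τ` on the time domain `I`, with harmonics
up to `B`: the span of `1`, `cos (2 π j t / τ)` and `sin (2 π j t / τ)` for `1 ≤ j ≤ B`.
(For `j = 0` the cosine is the constant `1` and the sine is `0`.) -/
def bandlimitedSpace (I : Set ℝ) (τ : ℝ) (B : ℕ) : Submodule ℝ (I → ℝ) :=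
  Submodule.span ℝ
    ((Set.range fun (j : Fin (B + 1)) (t : I) => Real.cos (2 * Real.pi * (j : ℕ) * t / τ)) ∪
      Set.range fun (j : Fin (B + 1)) (t : I) => Real.sin (2 * Real.pi * (j : ℕ) * t / τ))

/-- The two models for the coordinates of the trajectory: polynomials of degree `< K`, or
periodic bandlimited functions with `K = 2 B + 1` degrees of freedom. -/
def IsModelSpace (I : Set ℝ) (K : ℕ) (F : Submodule ℝ (I → ℝ)) : Prop :=
  F = polynomialSpace I K ∨
    ∃ τ : ℝ, 0 < τ ∧ ∃ B : ℕ, K = 2 * B + 1 ∧ F = bandlimitedSpace I τ B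

variable {I : Set ℝ} {D K M N : ℕ}

/-- The vector `(f₀(t), …, f_{K-1}(t))`. -/
def featureVec (f : Fin K → I → ℝ) (t : I) : Fin K → ℝ := fun k => f k t

/-- The trajectory `r(t) = C f(t)` in Euclidean space. -/
def trajectory (f : Fin K → I → ℝ) (C : Matrix (Fin D) (Fin K) ℝ) (t : I) :
    EuclideanSpace ℝ (Fin D) :=
  WithLp.toLp 2 (C *ᵥ featureVec f t)

/-- The range measurement `d n`: the distance from the anchor used in measurement `n` to the
position at time `t n`. -/
def rangeMeasurement (a : Fin M → EuclideanSpace ℝ (Fin D)) (m : Fin N → Fin M)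
    (f : Fin K → I → ℝ) (t : Fin N → I) (C : Matrix (Fin D) (Fin K) ℝ) (n : Fin N) : ℝ :=
  dist (a (m n)) (trajectory f C (t n))

/-- The right-hand side `b n = (‖a_{m n}‖² - (d n)²) / 2` computed from measured distances. -/
def linearData (a : Fin M → EuclideanSpace ℝ (Fin D)) (m : Fin N → Fin M)
    (d : Fin N → ℝ) (n : Fin N) : ℝ :=
  (1 / 2) * (‖a (m n)‖ ^ 2 - d n ^ 2)

/-- `(C, L)` solves the linearized system `b n = aᵀ C f - (1/2) fᵀ L f`, with `a` the anchor of
measurement `n` and `f` the feature vector at time `t n`. No relation between `C` and `L` is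
imposed. -/
def SolvesLinearized (a : Fin M → EuclideanSpace ℝ (Fin D)) (m : Fin N → Fin M)
    (f : Fin K → I → ℝ) (t : Fin N → I) (b : Fin N → ℝ)
    (C : Matrix (Fin D) (Fin K) ℝ) (L : Matrix (Fin K) (Fin K) ℝ) : Prop :=
  ∀ n, b n = (a (m n)).ofLp ⬝ᵥ (C *ᵥ featureVec f (t n))
    - (1 / 2) * (featureVec f (t n) ⬝ᵥ (L *ᵥ featureVec f (t n)))

/-- The number of measurements in which the `i`-th anchor is used. -/
def anchorCount (m : Fin N → Fin M) (i : Fin M) : ℕ :=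
  (Finset.univ.filter fun n => m n = i).card

end

end ContinuousLocalisation

namespace ContinuousLocalisation

open MeasureTheory Filter Module
open scoped Matrix ContDiff

/-! Expanding the squared distance shows that `(C, Cᵀ C)` always solves the linear system, so both
halves concern the homogeneous system in `(Δ, L)`.

Sufficiency: the quadratic term `fᵀ L f` ranges inside a space of dimension `2 K - 1` containing the
model space (`IsModelSpace.exists_features`). Replacing it by an arbitrary element of that space
leaves `K D + (2 K - 1)` scalar unknowns, which is the bound on `N`. A square subsystem has a
determinant analytic in the times, so one nonzero value makes it nonzero almost everywhere
(`ae_ne_zero_of_contDiff_omega`). The determinant is multilinear in its rows, and the values of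
independent functions span the coordinate space, so each row may be replaced by one of its
coefficient vectors (`exists_multilinear_eval_ne_zero`). A suitable choice is block diagonal: one
block per basis function, built from `D + 1` distinct anchors, and an identity. The anchor condition
is what supplies these blocks (`exists_rows_with_distinct_labels`).

Necessity: restrict the quadratic term to linear forms `cᵀ f`, possible because `1` lies in the
model space. The measurements with anchor `i` then impose at most `min (k_i) K` independent
conditions, fewer in total than the `K (D + 1)` unknowns. -/

/-! ### Generic nonvanishing of analytic functions and multilinear maps -/

/-- A real analytic function of `n` real variables that is not identically zero vanishes only on
a null set. -/
theorem ae_ne_zero_of_contDiff_omega {n : ℕ} (G : (Fin n → ℝ) → ℝ) (hG : ContDiff ℝ ω G)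
    (x₀ : Fin n → ℝ) (hx₀ : G x₀ ≠ 0) : ∀ᵐ x, G x ≠ 0 := by
  induction n with
  | zero => exact Eventually.of_forall fun x => by rwa [Subsingleton.elim x x₀]
  | succ n ih =>
    have hmp := volume_preserving_piFinSuccAbove (fun _ : Fin (n + 1) => ℝ) 0
    have hmeas : MeasurableSet {z : ℝ × (Fin n → ℝ) | ¬ G (Fin.cons z.1 z.2) ≠ 0} := by
      have : Continuous fun z : ℝ × (Fin n → ℝ) => G (Fin.cons z.1 z.2) :=
        hG.continuous.comp
          (Continuous.finCons (A := fun _ => ℝ) continuous_fst continuous_snd)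
      simp only [ne_eq, not_not]
      exact (measurableSet_singleton (0 : ℝ)).preimage this.measurable
    have hprod : ∀ᵐ z : ℝ × (Fin n → ℝ) ∂(volume.prod volume), G (Fin.cons z.1 z.2) ≠ 0 := by
      rw [ae_iff, Measure.measure_prod_null hmeas]
      have h1 : ContDiff ℝ ω fun s : ℝ => G (Fin.cons s (Fin.tail x₀)) := by
        refine hG.comp (contDiff_pi.2 fun i => ?_)
        refine Fin.cases ?_ (fun j => ?_) i
        · simpa using! contDiff_id
        · simpa using contDiff_const
      have h2 := h1.analyticOnNhd (s := Set.univ) |>.preimage_zero_mem_codiscrete (x := x₀ 0)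
        (by simpa using hx₀)
      have h3 : ∀ᵐ s : ℝ, G (Fin.cons s (Fin.tail x₀)) ≠ 0 := by
        have h4 := ae_restrict_le_codiscreteWithin (μ := (volume : Measure ℝ))
          MeasurableSet.univ h2
        rw [Measure.restrict_univ] at h4
        exact h4
      -- For such `s` the slice is nonzero at `Fin.tail x₀`, so the induction hypothesis applies to
      -- it; Fubini combines the slices.
      filter_upwards [h3] with s hs
      have h5 : ContDiff ℝ ω fun y : Fin n → ℝ => G (Fin.cons s y) := by
        refine hG.comp (contDiff_pi.2 fun i => ?_)
        refine Fin.cases ?_ (fun j => ?_) i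
        · simpa using contDiff_const
        · simpa using contDiff_apply ℝ ℝ j
      exact ih _ h5 _ hs
    have := hmp.quasiMeasurePreserving.ae hprod
    filter_upwards [this] with x hx
    simpa [MeasurableEquiv.piFinSuccAbove, Fin.insertNthEquiv, Fin.removeNth] using hx

/-- The values of a finite linearly independent family of functions span the coordinate space. -/
theorem span_range_eval_eq_top {ι X : Type*} [Fintype ι] [DecidableEq ι] {φ : ι → X → ℝ}
    (hφ : LinearIndependent ℝ φ) :
    Submodule.span ℝ (Set.range fun x : X => fun i => φ i x) = ⊤ := by
  by_contra h
  obtain ⟨g, hg0, hg⟩ := Submodule.exists_le_ker_of_lt_top _ (lt_top_iff_ne_top.2 h)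
  refine hg0 (LinearMap.pi_ext' fun i => LinearMap.ext_ring ?_)
  refine Fintype.linearIndependent_iff.1 hφ (fun i => g (Pi.single i 1)) (funext fun x => ?_) i
  have hx : g (fun i => φ i x) = 0 := hg (Submodule.subset_span ⟨x, rfl⟩)
  rw [pi_eq_sum_univ' (fun i => φ i x), map_sum] at hx
  simpa [mul_comm, Pi.single_apply, funext_iff, Pi.single, Function.update, eq_comm] using hx

/-- A multilinear map that does not vanish on some choice of coordinate combinations does not
vanish on some choice of values of linearly independent functions. -/
theorem exists_multilinear_eval_ne_zero {ι J X V : Type*} [Fintype ι] [DecidableEq ι] [Fintype J]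
    [AddCommGroup V] [Module ℝ V] {φ : ι → X → ℝ} (hφ : LinearIndependent ℝ φ)
    (μ : MultilinearMap ℝ (fun _ : J => V) ℝ) (w : J → ι → V) (σ : J → ι)
    (h : μ (fun j => w j (σ j)) ≠ 0) :
    ∃ t : J → X, μ (fun j => ∑ i, φ i (t j) • w j i) ≠ 0 := by
  by_contra! hzero
  let ℓ : J → (ι → ℝ) →ₗ[ℝ] V := fun j => Fintype.linearCombination ℝ (w j)
  have hspan := span_range_eval_eq_top hφ
  -- A basis made of value vectors: a multilinear map vanishing on all tuples of values vanishes on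
  -- basis tuples, hence everywhere.
  let b := Basis.ofSpan hspan.ge
  have hb : ∀ k, ∃ x, (fun i => φ i x) = b k := fun k =>
    Basis.ofSpan_subset hspan.ge ⟨k, rfl⟩
  have key : μ.compLinearMap ℓ = 0 := by
    refine Basis.ext_multilinear (fun _ => b) fun v => ?_
    choose x hx using hb
    have := hzero fun j => x (v j)
    simpa [ℓ, Fintype.linearCombination_apply, ← hx] using this
  refine h ?_
  have := congrArg (fun ν => ν fun j => Pi.single (σ j) (1 : ℝ)) key
  simpa [ℓ, Fintype.linearCombination_apply, Pi.single_apply] using this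

/-! ### Anchor geometry and the arrangement of measurements -/

/-- An affine function on `ℝ^D` that vanishes at `D + 1` affinely independent points is zero. -/
theorem eq_zero_of_affineIndependent {D : ℕ} {p : Fin (D + 1) → EuclideanSpace ℝ (Fin D)}
    (hp : AffineIndependent ℝ p) (x : Fin D → ℝ) (c : ℝ)
    (h : ∀ d, (p d).ofLp ⬝ᵥ x + c = 0) : x = 0 ∧ c = 0 := by
  have htop := hp.vectorSpan_eq_top_of_card_eq_finrank_add_one (by simp)
  have hx : x = 0 := by
    have hmem : ∀ v ∈ vectorSpan ℝ (Set.range p), v.ofLp ⬝ᵥ x = 0 := by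
      intro v hv
      induction hv using Submodule.span_induction with
      | mem v hv =>
        obtain ⟨_, ⟨i, rfl⟩, _, ⟨j, rfl⟩, rfl⟩ := hv
        have := h i
        have := h j
        simp only [vsub_eq_sub, WithLp.ofLp_sub, sub_dotProduct]
        linarith
      | zero => simp
      | add v w _ _ hv hw => simp [add_dotProduct, hv, hw]
      | smul r v _ hv => simp [smul_dotProduct, hv]
    have := hmem (WithLp.toLp 2 x) (htop ▸ Submodule.mem_top)
    simpa [dotProduct_self_eq_zero] using this
  exact ⟨hx, by simpa [hx] using h 0⟩

/-- If the labels of `N` items occur often enough, `K * L` of the items can be arranged in `K`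
rows of length `L` so that no label is repeated within a row. -/
theorem exists_rows_with_distinct_labels {N M K L : ℕ} (m : Fin N → Fin M)
    (h : K * L ≤ ∑ i : Fin M, min (anchorCount m i) K) :
    ∃ ρ : Fin K × Fin L → Fin N, Function.Injective ρ ∧
      ∀ k, Function.Injective fun d => m (ρ (k, d)) := by
  -- Keep at most `K` items per label; the hypothesis says that enough remain.
  have hsub : ∀ i : Fin M, ∃ s ⊆ Finset.univ.filter (fun n => m n = i),
      s.card = min (anchorCount m i) K :=
    fun i => Finset.exists_subset_card_eq (min_le_left _ _)
  choose s hs hcard using hsub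
  have hdisj : ∀ i ∈ (Finset.univ : Finset (Fin M)), ∀ j ∈ (Finset.univ : Finset (Fin M)),
      i ≠ j → Disjoint (s i) (s j) := by
    intro i _ j _ hij
    refine Finset.disjoint_left.2 fun n hi hj => hij ?_
    have h1 := hs i hi
    have h2 := hs j hj
    simp only [Finset.mem_filter] at h1 h2
    exact h1.2.symm.trans h2.2
  have hU : K * L ≤ (Finset.univ.biUnion s).card := by
    rw [Finset.card_biUnion hdisj]
    simpa [hcard] using h
  obtain ⟨A, hA, hAc⟩ := Finset.exists_subset_card_eq hU
  have hfib : ∀ i, (A.filter fun n => m n = i).card ≤ K := by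
    intro i
    have : A.filter (fun n => m n = i) ⊆ s i := by
      intro n hn
      rw [Finset.mem_filter] at hn
      obtain ⟨j, -, hj⟩ := Finset.mem_biUnion.1 (hA hn.1)
      have := hs j hj
      simp only [Finset.mem_filter] at this
      rw [← hn.2, this.2]
      exact hj
    exact (Finset.card_le_card this).trans ((hcard i).trans_le (min_le_right _ _))
  let u : Fin (K * L) → Fin N := A.orderEmbOfFin hAc
  let v : Fin (K * L) → Fin N := u ∘ Tuple.sort (m ∘ u)
  have hv : Function.Injective v :=
    (A.orderEmbOfFin hAc).injective.comp (Tuple.sort (m ∘ u)).injective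
  have hmono : Monotone (m ∘ v) := Tuple.monotone_sort (m ∘ u)
  have hvA : ∀ i, v i ∈ A := fun i => A.orderEmbOfFin_mem hAc _
  have hlt : ∀ (k : Fin K) (d : Fin L), (k : ℕ) + K * d < K * L := fun k d =>
    calc (k : ℕ) + K * d < K + K * d := by simp
      _ = K * (d + 1) := by ring
      _ ≤ K * L := Nat.mul_le_mul_left _ d.2
  -- The items are sorted by label and dealt cyclically to the `K` rows. Two items of one row are at
  -- least `K` positions apart, so a common label would fill at least `K + 1` consecutive positions.
  refine ⟨fun q => v ⟨q.1 + K * q.2, hlt q.1 q.2⟩, ?_, ?_⟩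
  · rintro ⟨k, d⟩ ⟨k', d'⟩ hq
    have hq' : (k : ℕ) + K * d = k' + K * d' := by simpa using hv hq
    have h1 := congrArg (· % K) hq'
    have h2 := congrArg (· / K) hq'
    have hK : 0 < K := k.pos
    simp only [Nat.add_mul_mod_self_left, Nat.mod_eq_of_lt k.2, Nat.mod_eq_of_lt k'.2] at h1
    simp only [Nat.add_mul_div_left _ _ hK, Nat.div_eq_of_lt k.2, Nat.div_eq_of_lt k'.2,
      zero_add] at h2
    exact Prod.ext (Fin.ext h1) (Fin.ext h2)
  · intro k
    have hno : ∀ d d' : Fin L, d < d' → m (v ⟨k + K * d, hlt k d⟩) ≠ m (v ⟨k + K * d', hlt k d'⟩) := by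
      intro d d' hdd heq
      have hK : K * (d : ℕ) + K ≤ K * d' := by
        have : (d : ℕ) + 1 ≤ d' := hdd
        calc K * (d : ℕ) + K = K * (d + 1) := by ring
          _ ≤ K * d' := Nat.mul_le_mul_left _ this
      let p : Fin (K * L) := ⟨k + K * d, hlt k d⟩
      let q : Fin (K * L) := ⟨k + K * d', hlt k d'⟩
      have himg : (Finset.Icc p q).image v ⊆ A.filter fun n => m n = m (v p) := by
        intro n hn
        obtain ⟨r, hr, rfl⟩ := Finset.mem_image.1 hn
        rw [Finset.mem_Icc] at hr
        refine Finset.mem_filter.2 ⟨hvA r, le_antisymm ?_ (hmono hr.1)⟩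
        exact (hmono hr.2).trans heq.ge
      have hc := (Finset.card_le_card himg).trans (hfib _)
      rw [Finset.card_image_of_injective _ hv, Fin.card_Icc] at hc
      simp only [p, q] at hc
      omega
    intro d d' hdd
    rcases lt_trichotomy d d' with h1 | h1 | h1
    · exact (hno d d' h1 hdd).elim
    · exact h1
    · exact (hno d' d h1 hdd.symm).elim

/-! ### The generically invertible square subsystem -/

/-- For almost all times the homogeneous linearized system, in the unknown matrix `Δ` and the
unknown coefficients `β` of a function in the span of `φ`, forces `Δ = 0`. -/
theorem ae_homogeneous_solution_eq_zero {ι : Type*} [Fintype ι] [DecidableEq ι] {D K M N : ℕ}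
    {φ : ι → ℝ → ℝ} (hφ : LinearIndependent ℝ φ) (hφc : ∀ i, ContDiff ℝ ω (φ i))
    {e : Fin K → ι} (he : Function.Injective e) (hN : K * D + Fintype.card ι ≤ N)
    {a : Fin M → EuclideanSpace ℝ (Fin D)}
    (ha : ∀ s : Fin (D + 1) ↪ Fin M, AffineIndependent ℝ fun i => a (s i))
    {m : Fin N → Fin M} (hm : K * (D + 1) ≤ ∑ i : Fin M, min (anchorCount m i) K) :
    ∀ᵐ t : Fin N → ℝ, ∀ (Δ : Matrix (Fin D) (Fin K) ℝ) (β : ι → ℝ),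
      (∀ n, (a (m n)).ofLp ⬝ᵥ (Δ *ᵥ fun k => φ (e k) (t n)) + ∑ i, β i * φ i (t n) = 0) →
        Δ = 0 := by
  classical
  obtain ⟨ρ₀, hρ₀, hrow⟩ := exists_rows_with_distinct_labels m hm
  have hcard : Fintype.card {i // i ∉ Set.range e} + K = Fintype.card ι := by
    have h1 := Fintype.card_subtype_compl fun i => i ∈ Set.range e
    have h2 : Fintype.card {i // i ∈ Set.range e} = K := by
      rw [← Fintype.card_congr (Equiv.ofInjective e he), Fintype.card_fin]
    have h3 := Fintype.card_le_of_injective e he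
    rw [Fintype.card_fin] at h3
    omega
  have hκ : Fintype.card {i // i ∉ Set.range e} ≤ Fintype.card {n // n ∉ Set.range ρ₀} := by
    have h1 := Fintype.card_subtype_compl fun n => n ∈ Set.range ρ₀
    have h2 : Fintype.card {n // n ∈ Set.range ρ₀} = K * (D + 1) := by
      rw [← Fintype.card_congr (Equiv.ofInjective ρ₀ hρ₀)]; simp
    rw [Fintype.card_fin, h2] at h1
    have h3 : K * (D + 1) = K * D + K := by ring
    omega
  obtain ⟨ρ₁⟩ := Function.Embedding.nonempty_of_card_le hκ
  -- `J` indexes both the selected equations and the unknowns. Column `(k, 0)` carries `β (e k)`,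
  -- column `(k, d + 1)` carries `Δ d k`, and the other columns carry the remaining `β i`.
  let J := (Fin K × Fin (D + 1)) ⊕ {i // i ∉ Set.range e}
  have hJ : ∀ g : J → ℝ, ∑ j, g j = ∑ q, g (Sum.inl q) + ∑ i, g (Sum.inr i) :=
    Fintype.sum_sum_type
  let ρ : J → Fin N := Sum.elim ρ₀ fun i => (ρ₁ i : Fin N)
  have hρ : Function.Injective ρ :=
    hρ₀.sumElim (Subtype.val_injective.comp ρ₁.injective)
      fun q i h => (ρ₁ i).2 ⟨q, h⟩
  let A : Fin N → Fin (D + 1) → ℝ := fun n => Fin.cons 1 (a (m n)).ofLp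
  let w : J → ι → J → ℝ := fun j i => Sum.elim
    (fun q => if e q.1 = i then A (ρ j) q.2 else 0) (fun i' => if i'.1 = i then 1 else 0)
  -- Selecting `e k` in the rows `(k, d)` isolates block `k`, with rows `(1, a)` for distinct
  -- anchors; selecting `i` in the remaining rows gives the identity.
  let σ : J → ι := Sum.elim (fun q => e q.1) (fun i => i.1)
  let R : (J → ℝ) → Matrix J J ℝ := fun t j => ∑ i, φ i (t j) • w j i
  have hR : ∀ t j, (∀ q, R t j (Sum.inl q) = φ (e q.1) (t j) * A (ρ j) q.2) ∧
      ∀ i, R t j (Sum.inr i) = φ i.1 (t j) := by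
    intro t j
    constructor <;> intro q <;> simp [R, w, Finset.sum_apply]
  have hW : (Matrix.of fun j => w j (σ j)).det ≠ 0 := by
    intro hdet
    obtain ⟨v, hv0, hv⟩ := Matrix.exists_mulVec_eq_zero_iff.2 hdet
    have hr : ∀ i, v (Sum.inr i) = 0 := by
      intro i
      have h1 : ∀ k, e k ≠ i.1 := fun k hk => i.2 ⟨k, hk⟩
      have := congrFun hv (Sum.inr i)
      simpa [Matrix.mulVec, dotProduct, hJ, w, σ, h1, ← Subtype.ext_iff]
        using this
    have hl : ∀ k, (fun d => v (Sum.inl (k, Fin.succ d))) = 0 ∧ v (Sum.inl (k, 0)) = 0 := by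
      intro k
      refine eq_zero_of_affineIndependent (ha ⟨_, hrow k⟩) _ _ fun d => ?_
      have := congrFun hv (Sum.inl (k, d))
      simpa [Matrix.mulVec, dotProduct, hJ, w, σ, hr, he.eq_iff,
        Fintype.sum_prod_type, Fin.sum_univ_succ, A, ρ, Finset.sum_add_distrib, add_comm,
        Finset.sum_comm (s := (Finset.univ : Finset (Fin K)))] using this
    refine hv0 (funext fun j => ?_)
    rcases j with ⟨k, d⟩ | i
    · refine Fin.cases (hl k).2 (fun d => congrFun (hl k).1 d) d
    · exact hr i
  obtain ⟨t₀, ht₀⟩ := exists_multilinear_eval_ne_zero hφ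
    (Matrix.detRowAlternating (n := J) (R := ℝ)).toMultilinearMap w σ hW
  have hsm : ContDiff ℝ ω fun t : Fin N → ℝ => (R (t ∘ ρ)).det := by
    have hent : ∀ j j', ContDiff ℝ ω fun t : Fin N → ℝ => R (t ∘ ρ) j j' := by
      intro j j'
      simp only [R, Finset.sum_apply, Pi.smul_apply, smul_eq_mul]
      exact ContDiff.sum fun i _ => ((hφc i).comp (contDiff_apply ℝ ℝ (ρ j))).mul contDiff_const
    simp only [Matrix.det_apply]
    exact ContDiff.sum fun τ _ => (contDiff_prod fun i _ => hent _ _).const_smul _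
  -- The determinant sees only the times `t ∘ ρ`, so the default value `0` elsewhere is immaterial.
  filter_upwards [ae_ne_zero_of_contDiff_omega _ hsm (Function.extend ρ t₀ 0)
    (by rw [Function.extend_comp hρ]; exact ht₀)] with t ht Δ β hsol
  let v : J → ℝ := Sum.elim
    (fun q => (Fin.cons (β (e q.1)) (fun d => Δ d q.1) : Fin (D + 1) → ℝ) q.2) (fun i => β i.1)
  have hv : R (t ∘ ρ) *ᵥ v = 0 := by
    funext j
    rw [Pi.zero_apply, ← hsol (ρ j)]
    have hsplit : ∑ i, β i * φ i (t (ρ j)) = ∑ k, β (e k) * φ (e k) (t (ρ j)) +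
        ∑ i : {i // i ∉ Set.range e}, β i.1 * φ i.1 (t (ρ j)) := by
      rw [← Fintype.sum_subtype_add_sum_subtype (fun i => i ∈ Set.range e)]
      congr 1
      convert ((Equiv.ofInjective e he).sum_comp
        fun i : Set.range e => β i.1 * φ i.1 (t (ρ j))).symm <;> rfl
    rw [hsplit]
    simp only [Matrix.mulVec, dotProduct, hJ, hR, Fintype.sum_prod_type,
      Fin.sum_univ_succ, A, v, Function.comp, Sum.elim_inl, Sum.elim_inr, Fin.cons_zero,
      Fin.cons_succ, Finset.sum_add_distrib, Finset.mul_sum]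
    rw [Finset.sum_comm (s := (Finset.univ : Finset (Fin D)))]
    have h1 : ∀ x y z x' y' z' : ℝ, x = y' → y = x' → z = z' → x + y + z = x' + (y' + z') := by
      intros; subst_vars; ring
    refine h1 _ _ _ _ _ _ ?_ ?_ ?_
    · exact Finset.sum_congr rfl fun k _ => by ring
    · exact Finset.sum_congr rfl fun k _ => Finset.sum_congr rfl fun d _ => by ring
    · exact Finset.sum_congr rfl fun k _ => by ring
  have hv0 := Matrix.eq_zero_of_mulVec_eq_zero ht hv
  ext d k
  simpa [v] using congrFun hv0 (Sum.inl (k, d.succ))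

/-! ### Polynomial and harmonic model spaces -/

section

variable {I : Set ℝ} {K : ℕ}

/-- The monomials are linearly independent functions. -/
theorem linearIndependent_monomials (n : ℕ) :
    LinearIndependent ℝ fun (i : Fin n) (t : ℝ) => t ^ (i : ℕ) := by
  refine Fintype.linearIndependent_iff.2 fun c hc i => ?_
  have hp : ∑ i : Fin n, Polynomial.monomial (i : ℕ) (c i) = 0 := by
    refine Polynomial.funext fun t => ?_
    simpa [Polynomial.eval_finsetSum] using congrFun hc t
  have := congrArg (fun p => Polynomial.coeff p (i : ℕ)) hp
  simpa [Polynomial.finsetSum_coeff, Polynomial.coeff_monomial, Fin.val_inj] using this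

/-- The complex exponential of period `τ` and frequency `k`, as a character. -/
noncomputable def expChar (τ : ℝ) (k : ℤ) : Multiplicative ℝ →* ℂ where
  toFun t := Complex.exp (((2 * Real.pi * k * t.toAdd / τ : ℝ) : ℂ) * Complex.I)
  map_one' := by simp
  map_mul' s t := by
    rw [← Complex.exp_add]
    congr 1
    push_cast [toAdd_mul]
    ring

/-- At time `τ / (2 (k - l))` the two exponentials differ by the factor `exp (π i) = -1`. -/
theorem expChar_injective {τ : ℝ} (hτ : 0 < τ) : Function.Injective (expChar τ) := by
  intro k l hkl
  by_contra hne
  have hd : ((k : ℝ) - l) ≠ 0 := sub_ne_zero.2 (by exact_mod_cast hne)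
  have h1 := DFunLike.congr_fun hkl (Multiplicative.ofAdd (τ / (2 * ((k : ℝ) - l))))
  simp only [expChar, MonoidHom.coe_mk, OneHom.coe_mk, toAdd_ofAdd] at h1
  have h2 := congrArg (fun z => z * Complex.exp
    (-(((2 * Real.pi * l * (τ / (2 * ((k : ℝ) - l))) / τ : ℝ) : ℂ) * Complex.I))) h1
  simp only [← Complex.exp_add, add_neg_cancel, Complex.exp_zero] at h2
  have h3 : (((2 * Real.pi * k * (τ / (2 * ((k : ℝ) - l))) / τ : ℝ) : ℂ) * Complex.I) +
      -(((2 * Real.pi * l * (τ / (2 * ((k : ℝ) - l))) / τ : ℝ) : ℂ) * Complex.I) =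
      Real.pi * Complex.I := by
    rw [← sub_eq_add_neg, ← sub_mul, ← Complex.ofReal_sub]
    congr 2
    field_simp
  rw [h3, Complex.exp_pi_mul_I] at h2
  norm_num at h2

/-- The real harmonics of period `τ`: cosines for `k ≥ 0` and sines for `k < 0`. -/
noncomputable def harmonic (τ : ℝ) (k : ℤ) (t : ℝ) : ℝ :=
  if 0 ≤ k then Real.cos (2 * Real.pi * k * t / τ) else Real.sin (2 * Real.pi * k * t / τ)

theorem contDiff_harmonic (τ : ℝ) (k : ℤ) : ContDiff ℝ ω (harmonic τ k) := by
  have h : ContDiff ℝ ω fun t : ℝ => 2 * Real.pi * k * t / τ :=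
    (contDiff_const.mul contDiff_id).div_const τ
  unfold harmonic
  split_ifs
  · exact Real.contDiff_cos.comp h
  · exact Real.contDiff_sin.comp h

/-- The phase `1` or `-i` for which `harmonic` is the real part of the multiple of the
exponential. -/
noncomputable def harmonicPhase (k : ℤ) : ℂ := if 0 ≤ k then 1 else -Complex.I

theorem two_mul_harmonic (τ : ℝ) (k : ℤ) (t : ℝ) :
    2 * (harmonic τ k t : ℂ) = harmonicPhase k * expChar τ k (Multiplicative.ofAdd t) +
      (starRingEnd ℂ) (harmonicPhase k) * expChar τ (-k) (Multiplicative.ofAdd t) := by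
  have hneg : (2 * Real.pi * ((-k : ℤ) : ℝ) * t / τ) = -(2 * Real.pi * k * t / τ) := by
    push_cast; ring
  simp only [expChar, MonoidHom.coe_mk, OneHom.coe_mk, toAdd_ofAdd, hneg, Complex.ofReal_neg,
    Complex.exp_mul_I, Complex.cos_neg, Complex.sin_neg]
  unfold harmonic harmonicPhase
  split_ifs
  · simp only [map_one, Complex.ofReal_cos]
    ring
  · simp only [map_neg, Complex.conj_I, Complex.ofReal_sin]
    linear_combination (2 * Complex.sin ((2 * Real.pi * k * t / τ : ℝ) : ℂ)) * Complex.I_sq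

/-- A relation among harmonics becomes one among the distinct characters `expChar τ k`, which
Dedekind's theorem makes trivial. -/
theorem linearIndependent_harmonic {τ : ℝ} (hτ : 0 < τ) :
    LinearIndependent ℝ (harmonic τ) := by
  refine linearIndependent_iff''.2 fun s g hg hsum => ?_
  -- Each harmonic involves the frequencies `k` and `-k`, so the support is made symmetric before
  -- coefficients are collected.
  let S := s ∪ s.image Neg.neg
  have hS : ∀ k, -k ∈ S ↔ k ∈ S := by
    intro k
    simp only [S, Finset.mem_union, Finset.mem_image]
    constructor
    · rintro (h | ⟨j, hj, h⟩)
      · exact Or.inr ⟨-k, h, neg_neg k⟩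
      · exact Or.inl (neg_injective h ▸ hj)
    · rintro (h | ⟨j, hj, rfl⟩)
      · exact Or.inr ⟨k, h, rfl⟩
      · exact Or.inl (by simpa using hj)
  have hsumS : ∀ t, ∑ k ∈ S, g k * harmonic τ k t = 0 := by
    intro t
    have h1 := congrFun hsum t
    simp only [Finset.sum_apply, Pi.smul_apply, smul_eq_mul, Pi.zero_apply] at h1
    rw [← h1]
    refine (Finset.sum_subset Finset.subset_union_left fun k _ hk => ?_).symm
    rw [hg k hk, zero_mul]
  let c : ℤ → ℂ := fun k =>
    g k * harmonicPhase k + g (-k) * (starRingEnd ℂ) (harmonicPhase (-k))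
  have hc : ∀ k ∈ S, c k = 0 := by
    have hind := (linearIndependent_monoidHom (Multiplicative ℝ) ℂ).comp _ (expChar_injective hτ)
    refine linearIndependent_iff'.1 hind S c (funext fun t => ?_)
    have h2 : ∑ k ∈ S, (g k : ℂ) * (2 * (harmonic τ k t.toAdd : ℂ)) = 0 := by
      have := congrArg (fun x : ℝ => (2 * x : ℂ)) (hsumS t.toAdd)
      simp only [Complex.ofReal_sum, Complex.ofReal_mul, Complex.ofReal_zero, mul_zero,
        Finset.mul_sum] at this
      rw [← this]
      exact Finset.sum_congr rfl fun k _ => by ring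
    have h3 : ∑ k ∈ S, (g (-k) : ℂ) * (starRingEnd ℂ) (harmonicPhase (-k)) * expChar τ k t =
        ∑ k ∈ S, (g k : ℂ) * (starRingEnd ℂ) (harmonicPhase k) * expChar τ (-k) t :=
      Finset.sum_nbij' Neg.neg Neg.neg (fun k hk => (hS k).2 hk) (fun k hk => (hS k).2 hk)
        (fun k _ => neg_neg k) (fun k _ => neg_neg k) (fun k _ => by rw [neg_neg])
    simp only [Finset.sum_apply, Pi.smul_apply, smul_eq_mul, Pi.zero_apply, Function.comp, c,
      add_mul, Finset.sum_add_distrib]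
    rw [h3, ← h2, ← Finset.sum_add_distrib]
    refine Finset.sum_congr rfl fun k _ => ?_
    rw [two_mul_harmonic, ofAdd_toAdd]
    ring
  have hc' : ∀ k, c k = 0 := by
    intro k
    by_cases hk : k ∈ S
    · exact hc k hk
    · have h1 : g k = 0 := hg k fun h => hk (Finset.mem_union_left _ h)
      have h2 : g (-k) = 0 := hg (-k) fun h => hk ((hS k).1 (Finset.mem_union_left _ h))
      simp [c, h1, h2]
  -- For `k > 0` the coefficient is `g k + i g (-k)`; its real and imaginary parts separate cosine
  -- from sine.
  have hpos : ∀ k : ℤ, 0 < k → g k = 0 ∧ g (-k) = 0 := by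
    intro k hk
    have h1 := hc' k
    have h2 : ¬ (0 ≤ -k) := by omega
    simp only [c, harmonicPhase, hk.le, if_true, h2, if_false] at h1
    have hre := congrArg Complex.re h1
    have him := congrArg Complex.im h1
    simp at hre him
    exact ⟨hre, him⟩
  intro k
  rcases lt_trichotomy k 0 with hk | rfl | hk
  · simpa using (hpos (-k) (by omega)).2
  · have h1 := hc' 0
    simp only [c, harmonicPhase, neg_zero, le_refl, if_true, map_one, mul_one] at h1
    have h2 : (g 0 : ℝ) + g 0 = 0 := by exact_mod_cast h1
    linarith
  · exact (hpos k hk).1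

theorem cos_mem_span_harmonic (τ : ℝ) {n k : ℤ} (hk : |k| ≤ n) :
    (fun t : ℝ => Real.cos (2 * Real.pi * k * t / τ)) ∈
      Submodule.span ℝ (Set.range fun i : Finset.Icc (-n) n => harmonic τ i) := by
  refine Submodule.subset_span ⟨⟨|k|, Finset.mem_Icc.2 ⟨?_, hk⟩⟩, funext fun t => ?_⟩
  · have := abs_nonneg k
    omega
  · simp only [harmonic, abs_nonneg, if_true]
    rcases abs_choice k with h | h <;> rw [h]
    rw [← Real.cos_neg]
    congr 1
    push_cast
    ring

theorem sin_mem_span_harmonic (τ : ℝ) {n k : ℤ} (hk : |k| ≤ n) :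
    (fun t : ℝ => Real.sin (2 * Real.pi * k * t / τ)) ∈
      Submodule.span ℝ (Set.range fun i : Finset.Icc (-n) n => harmonic τ i) := by
  rw [abs_le] at hk
  rcases lt_trichotomy k 0 with h | rfl | h
  · exact Submodule.subset_span ⟨⟨k, Finset.mem_Icc.2 hk⟩, funext fun t => by
      simp [harmonic, not_le.2 h]⟩
  · convert Submodule.zero_mem _ using 1
    funext t
    simp
  · rw [← Submodule.neg_mem_iff]
    refine Submodule.subset_span ⟨⟨-k, Finset.mem_Icc.2 ⟨by omega, by omega⟩⟩, funext fun t => ?_⟩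
    have : ¬ (0 ≤ -k) := by omega
    simp only [harmonic, this, if_false, Pi.neg_apply]
    rw [← Real.sin_neg]
    congr 1
    push_cast
    ring

/-- Products of harmonics of frequency at most `n` are combinations of harmonics of frequency at
most `2 n`. -/
theorem harmonic_mul_mem_span (τ : ℝ) {n k l : ℤ} (hk : |k| ≤ n) (hl : |l| ≤ n) :
    (fun t : ℝ => harmonic τ k t * harmonic τ l t) ∈
      Submodule.span ℝ (Set.range fun i : Finset.Icc (-(2 * n)) (2 * n) => harmonic τ i) := by
  rw [abs_le] at hk hl
  have hp : |k + l| ≤ 2 * n := abs_le.2 ⟨by omega, by omega⟩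
  have hm : |k - l| ≤ 2 * n := abs_le.2 ⟨by omega, by omega⟩
  have cp := Submodule.smul_mem _ (1 / 2 : ℝ) (cos_mem_span_harmonic τ hp)
  have cm := Submodule.smul_mem _ (1 / 2 : ℝ) (cos_mem_span_harmonic τ hm)
  have sp := Submodule.smul_mem _ (1 / 2 : ℝ) (sin_mem_span_harmonic τ hp)
  have sm := Submodule.smul_mem _ (1 / 2 : ℝ) (sin_mem_span_harmonic τ hm)
  have ep : ∀ t : ℝ, 2 * Real.pi * ((k + l : ℤ) : ℝ) * t / τ =
      2 * Real.pi * k * t / τ + 2 * Real.pi * l * t / τ := fun t => by push_cast; ring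
  have em : ∀ t : ℝ, 2 * Real.pi * ((k - l : ℤ) : ℝ) * t / τ =
      2 * Real.pi * k * t / τ - 2 * Real.pi * l * t / τ := fun t => by push_cast; ring
  by_cases h0 : 0 ≤ k <;> by_cases h1 : 0 ≤ l
  · convert Submodule.add_mem _ cp cm using 1
    funext t
    simp only [harmonic, h0, h1, if_true, Pi.add_apply, Pi.smul_apply, smul_eq_mul, ep, em,
      Real.cos_add, Real.cos_sub]
    ring
  · convert Submodule.sub_mem _ sp sm using 1
    funext t
    simp only [harmonic, h0, h1, if_true, if_false, Pi.sub_apply, Pi.smul_apply, smul_eq_mul, ep,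
      em, Real.sin_add, Real.sin_sub]
    ring
  · convert Submodule.add_mem _ sp sm using 1
    funext t
    simp only [harmonic, h0, h1, if_true, if_false, Pi.add_apply, Pi.smul_apply, smul_eq_mul, ep,
      em, Real.sin_add, Real.sin_sub]
    ring
  · convert Submodule.sub_mem _ cm cp using 1
    funext t
    simp only [harmonic, h0, h1, if_false, Pi.sub_apply, Pi.smul_apply, smul_eq_mul, ep, em,
      Real.cos_add, Real.cos_sub]
    ring

theorem bandlimitedSpace_eq_span_harmonic (I : Set ℝ) (τ : ℝ) (B : ℕ) :
    bandlimitedSpace I τ B = Submodule.span ℝ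
      (Set.range fun (k : Fin (2 * B + 1)) (t : I) => harmonic τ ((k : ℤ) - B) t) := by
  refine le_antisymm (Submodule.span_le.2 ?_) (Submodule.span_le.2 ?_)
  · rintro _ (⟨j, rfl⟩ | ⟨j, rfl⟩)
    · refine Submodule.subset_span ⟨⟨j + B, by omega⟩, funext fun t => ?_⟩
      simp [harmonic]
    · rcases Nat.eq_zero_or_pos (j : ℕ) with hj | hj
      · have h0 : (fun t : I => Real.sin (2 * Real.pi * (j : ℕ) * t / τ)) = 0 :=
          funext fun t => by simp [hj]
        beta_reduce
        rw [SetLike.mem_coe, h0]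
        exact Submodule.zero_mem _
      · rw [SetLike.mem_coe, ← Submodule.neg_mem_iff]
        refine Submodule.subset_span ⟨⟨B - j, by omega⟩, funext fun t => ?_⟩
        have h1 : (((B - (j : ℕ) : ℕ) : ℤ) - B) = -((j : ℕ) : ℤ) := by omega
        have h2 : ¬ (0 ≤ -((j : ℕ) : ℤ)) := by omega
        simp only [h1, harmonic, h2, if_false, Pi.neg_apply]
        rw [← Real.sin_neg]
        congr 1
        push_cast
        ring
  · rintro _ ⟨k, rfl⟩
    by_cases h : (0 : ℤ) ≤ (k : ℤ) - B
    · refine Submodule.subset_span (Or.inl ⟨⟨k - B, by omega⟩, funext fun t => ?_⟩)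
      have h1 : (k : ℤ) - B = ((k - B : ℕ) : ℤ) := by omega
      simp only [harmonic, h, if_true]
      rw [h1]
      simp
    · rw [SetLike.mem_coe, ← Submodule.neg_mem_iff]
      refine Submodule.subset_span (Or.inr ⟨⟨B - k, by omega⟩, funext fun t => ?_⟩)
      have h1 : (k : ℤ) - B = -((B - k : ℕ) : ℤ) := by omega
      simp only [harmonic, h, if_false, Pi.neg_apply]
      rw [h1, ← Real.sin_neg]
      congr 1
      push_cast
      ring

/-- A model space has a basis that is part of a linearly independent family of `2 K - 1` real
analytic functions on the line whose span contains the products of the basis functions. -/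
theorem IsModelSpace.exists_features {F : Submodule ℝ (I → ℝ)} (hF : IsModelSpace I K F) :
    ∃ (ι : Type) (_ : Fintype ι) (φ : ι → ℝ → ℝ) (e : Fin K → ι),
      LinearIndependent ℝ φ ∧ (∀ i, ContDiff ℝ ω (φ i)) ∧ Function.Injective e ∧
      Fintype.card ι = 2 * K - 1 ∧
      (∀ k l, (fun t => φ (e k) t * φ (e l) t) ∈ Submodule.span ℝ (Set.range φ)) ∧
      F = Submodule.span ℝ (Set.range fun k (t : I) => φ (e k) t) := by
  rcases hF with rfl | ⟨τ, hτ, B, rfl, rfl⟩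
  -- Products of monomials of degree below `K` have degree at most `2 K - 2`.
  · refine ⟨Fin (2 * K - 1), inferInstance, fun i t => t ^ (i : ℕ),
      Fin.castLE (by omega), linearIndependent_monomials _, fun i => contDiff_id.pow _,
      Fin.castLE_injective _, Fintype.card_fin _, fun k l => ?_, rfl⟩
    exact Submodule.subset_span ⟨⟨k + l, by omega⟩, funext fun t => pow_add t k l⟩
  · have hk : ∀ k : Fin (2 * B + 1), |(k : ℤ) - B| ≤ (B : ℤ) := fun k =>
      abs_le.2 ⟨by omega, by omega⟩
    -- Products double the band: the frequencies from `-2 B` to `2 B` number `4 B + 1 = 2 K - 1`.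
    refine ⟨Finset.Icc (-(2 * B : ℤ)) (2 * B), inferInstance, fun i => harmonic τ i,
      fun k => ⟨(k : ℤ) - B, ?_⟩, (linearIndependent_harmonic hτ).comp _ Subtype.val_injective,
      fun i => contDiff_harmonic τ i, fun k l hkl => ?_, ?_,
      fun k l => harmonic_mul_mem_span τ (hk k) (hk l), bandlimitedSpace_eq_span_harmonic I τ B⟩
    · exact Finset.mem_Icc.2 ⟨by omega, by omega⟩
    · have := congrArg Subtype.val hkl
      exact Fin.ext (by simpa using this)
    · rw [Fintype.card_coe, Int.card_Icc]
      omega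

theorem IsModelSpace.one_mem {F : Submodule ℝ (I → ℝ)} (hF : IsModelSpace I K F) (hK : 0 < K) :
    (1 : I → ℝ) ∈ F := by
  rcases hF with rfl | ⟨τ, -, B, -, rfl⟩
  · exact Submodule.subset_span ⟨⟨0, hK⟩, funext fun t => by simp⟩
  · exact Submodule.subset_span (Or.inl ⟨0, funext fun t => by simp⟩)

end

/-! ### Reduction to the homogeneous system -/

section

variable {I : Set ℝ} {D K M N : ℕ}

/-- Expanding `‖a - r‖²` leaves `⟨a, r⟩ - ‖r‖² / 2`, with `‖r‖² = fᵀ Cᵀ C f`. -/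
theorem linearData_rangeMeasurement (a : Fin M → EuclideanSpace ℝ (Fin D)) (m : Fin N → Fin M)
    (f : Fin K → I → ℝ) (t : Fin N → I) (C : Matrix (Fin D) (Fin K) ℝ) (n : Fin N) :
    linearData a m (rangeMeasurement a m f t C) n =
      (a (m n)).ofLp ⬝ᵥ (C *ᵥ featureVec f (t n)) -
        (1 / 2) * (featureVec f (t n) ⬝ᵥ ((Cᵀ * C) *ᵥ featureVec f (t n))) := by
  have h1 : inner ℝ (a (m n)) (trajectory f C (t n)) =
      (a (m n)).ofLp ⬝ᵥ (C *ᵥ featureVec f (t n)) := by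
    rw [EuclideanSpace.inner_eq_star_dotProduct, star_trivial, dotProduct_comm]
    rfl
  have h2 : ‖trajectory f C (t n)‖ ^ 2 =
      featureVec f (t n) ⬝ᵥ ((Cᵀ * C) *ᵥ featureVec f (t n)) := by
    rw [← real_inner_self_eq_norm_sq, EuclideanSpace.inner_eq_star_dotProduct, star_trivial,
      ← Matrix.mulVec_mulVec, Matrix.dotProduct_mulVec, Matrix.vecMul_transpose]
    rfl
  rw [linearData, rangeMeasurement, dist_eq_norm, norm_sub_sq_real, h1, h2]
  ring

/-- Solutions of the linearized system for data produced by `C` differ from `(C, Cᵀ C)` by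
solutions of the homogeneous system. -/
theorem solvesLinearized_linearData_iff (a : Fin M → EuclideanSpace ℝ (Fin D))
    (m : Fin N → Fin M) (f : Fin K → I → ℝ) (t : Fin N → I) (C C' : Matrix (Fin D) (Fin K) ℝ)
    (L : Matrix (Fin K) (Fin K) ℝ) :
    SolvesLinearized a m f t (linearData a m (rangeMeasurement a m f t C)) C' L ↔
      ∀ n, (a (m n)).ofLp ⬝ᵥ ((C' - C) *ᵥ featureVec f (t n)) -
        (1 / 2) * (featureVec f (t n) ⬝ᵥ ((L - Cᵀ * C) *ᵥ featureVec f (t n))) = 0 := by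
  refine forall_congr' fun n => ?_
  rw [linearData_rangeMeasurement, Matrix.sub_mulVec, Matrix.sub_mulVec, dotProduct_sub,
    dotProduct_sub, eq_comm, ← sub_eq_zero]
  constructor <;> intro h <;> linarith

theorem solvesLinearized_self (a : Fin M → EuclideanSpace ℝ (Fin D)) (m : Fin N → Fin M)
    (f : Fin K → I → ℝ) (t : Fin N → I) (C : Matrix (Fin D) (Fin K) ℝ) :
    SolvesLinearized a m f t (linearData a m (rangeMeasurement a m f t C)) C (Cᵀ * C) :=
  linearData_rangeMeasurement a m f t C

/-- A basis of a space spanned by `K` functions is obtained from them by an invertible matrix. -/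
theorem exists_changeOfBasis {X : Type*} {f g : Fin K → X → ℝ} (hf : LinearIndependent ℝ f)
    (h : Submodule.span ℝ (Set.range f) = Submodule.span ℝ (Set.range g)) :
    ∃ A : Matrix (Fin K) (Fin K) ℝ, A.det ≠ 0 ∧
      ∀ x, (fun k => f k x) = A *ᵥ fun k => g k x := by
  have hmem : ∀ k, ∃ c : Fin K → ℝ, ∑ l, c l • g l = f k := fun k =>
    (Submodule.mem_span_range_iff_exists_fun ℝ).1 (h ▸ Submodule.subset_span ⟨k, rfl⟩)
  choose A hA using hmem
  have hAx : ∀ x, (fun k => f k x) = Matrix.of A *ᵥ fun k => g k x := by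
    intro x
    funext k
    rw [← hA k]
    simp [Matrix.mulVec, dotProduct]
  refine ⟨Matrix.of A, fun hdet => ?_, hAx⟩
  -- A left null vector of the matrix would be a linear relation among the `f k`.
  obtain ⟨v, hv0, hv⟩ := Matrix.exists_vecMul_eq_zero_iff.2 hdet
  refine hv0 (funext (Fintype.linearIndependent_iff.1 hf v (funext fun x => ?_)))
  have : v ⬝ᵥ (fun k => f k x) = 0 := by
    rw [hAx, Matrix.dotProduct_mulVec, hv, zero_dotProduct]
  simpa [dotProduct] using this

/-- Quadratic forms in functions are combinations of the functions spanning their products. -/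
theorem quadraticForm_mem_span {ι X : Type*} {φ : ι → X → ℝ} {g : Fin K → X → ℝ}
    (h : ∀ k l, (fun x => g k x * g l x) ∈ Submodule.span ℝ (Set.range φ))
    (L : Matrix (Fin K) (Fin K) ℝ) :
    (fun x => (fun k => g k x) ⬝ᵥ (L *ᵥ fun k => g k x)) ∈ Submodule.span ℝ (Set.range φ) := by
  have : (fun x => (fun k => g k x) ⬝ᵥ (L *ᵥ fun k => g k x)) =
      ∑ k, ∑ l, L k l • fun x => g k x * g l x := by
    funext x
    simp only [dotProduct, Matrix.mulVec, Finset.mul_sum, Finset.sum_apply, Pi.smul_apply,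
      smul_eq_mul]
    exact Finset.sum_congr rfl fun k _ => Finset.sum_congr rfl fun l _ => by ring
  rw [this]
  exact Submodule.sum_mem _ fun k _ => Submodule.sum_mem _ fun l _ =>
    Submodule.smul_mem _ _ (h k l)

/-- For almost all times the homogeneous linearized system has only solutions with vanishing
trajectory part. -/
theorem IsModelSpace.ae_homogeneous_solution_eq_zero {F : Submodule ℝ (I → ℝ)}
    (hF : IsModelSpace I K F) {f : Fin K → I → ℝ} (hf : LinearIndependent ℝ f)
    (hspan : Submodule.span ℝ (Set.range f) = F) {a : Fin M → EuclideanSpace ℝ (Fin D)}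
    (ha : ∀ s : Fin (D + 1) ↪ Fin M, AffineIndependent ℝ fun i => a (s i))
    {m : Fin N → Fin M} (hN : K * (D + 2) - 1 ≤ N)
    (hm : K * (D + 1) ≤ ∑ i : Fin M, min (anchorCount m i) K) :
    ∀ᵐ s : Fin N → ℝ, ∀ t : Fin N → I, (fun n => (t n : ℝ)) = s →
      ∀ (Δ : Matrix (Fin D) (Fin K) ℝ) (L : Matrix (Fin K) (Fin K) ℝ),
        (∀ n, (a (m n)).ofLp ⬝ᵥ (Δ *ᵥ featureVec f (t n)) -
          (1 / 2) * (featureVec f (t n) ⬝ᵥ (L *ᵥ featureVec f (t n))) = 0) → Δ = 0 := by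
  classical
  obtain ⟨ι, _, φ, e, hφ, hφc, he, hcard, hmul, hFe⟩ := hF.exists_features
  obtain ⟨A, hdet, hA⟩ := exists_changeOfBasis hf (hspan.trans hFe)
  have hN' : K * D + Fintype.card ι ≤ N := by
    rw [hcard]
    have : K * (D + 2) = K * D + 2 * K := by ring
    -- The subtraction in `2 * K - 1` truncates at `K = 0`.
    rcases Nat.eq_zero_or_pos K with rfl | hK
    · simp
    · omega
  filter_upwards [ContinuousLocalisation.ae_homogeneous_solution_eq_zero hφ hφc he hN' ha hm]
    with s hs t hts Δ L hsol
  subst hts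
  obtain ⟨β, hβ⟩ := (Submodule.mem_span_range_iff_exists_fun ℝ).1
    (quadraticForm_mem_span hmul (-(1 / 2 : ℝ) • (Aᵀ * L * A)))
  -- In the basis `φ ∘ e` the trajectory unknown becomes `Δ * A` and the quadratic term is absorbed
  -- into `β`.
  have hΔA : Δ * A = 0 := by
    refine hs (Δ * A) β fun n => ?_
    rw [← hsol n]
    have hAt : featureVec f (t n) = A *ᵥ fun k => φ (e k) (t n) := hA (t n)
    have h1 := congrFun hβ (t n)
    simp only [Finset.sum_apply, Pi.smul_apply, smul_eq_mul] at h1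
    have hq : ∀ g : Fin K → ℝ, g ⬝ᵥ ((Aᵀ * L * A) *ᵥ g) = (A *ᵥ g) ⬝ᵥ (L *ᵥ (A *ᵥ g)) := by
      intro g
      rw [Matrix.mul_assoc, ← Matrix.mulVec_mulVec, Matrix.dotProduct_mulVec,
        Matrix.vecMul_transpose, Matrix.mulVec_mulVec]
    rw [h1, hAt, Matrix.mulVec_mulVec, Matrix.smul_mulVec, dotProduct_smul, smul_eq_mul, hq]
    ring
  have hunit : IsUnit A.det := isUnit_iff_ne_zero.2 hdet
  calc Δ = Δ * A * A⁻¹ := by rw [Matrix.mul_assoc, Matrix.mul_nonsing_inv _ hunit, Matrix.mul_one]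
    _ = 0 := by rw [hΔA, Matrix.zero_mul]

/-! ### Necessity by dimension count -/

/-- If the anchors are not used often enough, the system with an affine function of the anchor
has a nonzero solution. -/
theorem exists_ne_zero_anchor_solution (m : Fin N → Fin M) (α : Fin M → Fin D → ℝ)
    (u : Fin N → Fin K → ℝ) (h : ∑ i : Fin M, min (anchorCount m i) K < K * (D + 1)) :
    ∃ (Δ : Matrix (Fin D) (Fin K) ℝ) (c : Fin K → ℝ), (Δ ≠ 0 ∨ c ≠ 0) ∧
      ∀ n, α (m n) ⬝ᵥ (Δ *ᵥ u n) + c ⬝ᵥ u n = 0 := by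
  let V := Matrix (Fin D) (Fin K) ℝ × (Fin K → ℝ)
  let Q : (i : Fin M) → (Fin K → ℝ) →ₗ[ℝ] ({n // m n = i} → ℝ) := fun i =>
    Matrix.mulVecLin (Matrix.of fun n : {n // m n = i} => u n)
  let S : (i : Fin M) → V →ₗ[ℝ] (Fin K → ℝ) := fun i =>
    { toFun := fun z => α i ᵥ* z.1 + z.2
      map_add' := fun y z => by
        change α i ᵥ* (y.1 + z.1) + (y.2 + z.2) = _
        rw [Matrix.vecMul_add]
        abel
      map_smul' := fun r z => by
        change α i ᵥ* (r • z.1) + r • z.2 = r • (α i ᵥ* z.1 + z.2)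
        rw [Matrix.vecMul_smul, smul_add] }
  -- The equations of anchor `i` involve the unknowns only through `α iᵀ Δ + c` in `ℝ^K`. Taking the
  -- range of `Q i` as target bounds its dimension by both `k_i` and `K`.
  let Φ : V →ₗ[ℝ] ((i : Fin M) → LinearMap.range (Q i)) :=
    LinearMap.pi fun i => (Q i).rangeRestrict ∘ₗ S i
  have hrank : ∀ i, finrank ℝ (LinearMap.range (Q i)) ≤ min (anchorCount m i) K := by
    intro i
    refine le_min ?_ ?_
    · refine (Submodule.finrank_le _).trans ?_
      rw [finrank_fintype_fun_eq_card, Fintype.card_subtype]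
      exact le_rfl
    · simpa using LinearMap.finrank_range_le (Q i)
  have hlt : finrank ℝ ((i : Fin M) → LinearMap.range (Q i)) < finrank ℝ V := by
    rw [finrank_pi_fintype]
    refine (Finset.sum_le_sum fun i _ => hrank i).trans_lt (h.trans_eq ?_)
    rw [finrank_prod, finrank_matrix, finrank_fintype_fun_eq_card]
    simp
    ring
  obtain ⟨⟨Δ, c⟩, hker, hne⟩ :=
    (Submodule.ne_bot_iff _).1 (LinearMap.ker_ne_bot_of_finrank_lt (f := Φ) hlt)
  refine ⟨Δ, c, ?_, fun n => ?_⟩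
  · by_contra! h0
    exact hne (Prod.ext h0.1 h0.2)
  · have h1 := congrArg Subtype.val (congrFun (LinearMap.mem_ker.1 hker) (m n))
    have h2 : u n ⬝ᵥ (α (m n) ᵥ* Δ + c) = 0 := congrFun h1 ⟨n, rfl⟩
    rw [← h2, dotProduct_add, Matrix.dotProduct_mulVec, dotProduct_comm (u n),
      dotProduct_comm (u n)]

/-- If the anchors are not used often enough, the homogeneous linearized system has a solution
with nonzero trajectory part. -/
theorem exists_ne_zero_homogeneous_solution (hD : 1 ≤ D) {f : Fin K → I → ℝ}
    (hone : (1 : I → ℝ) ∈ Submodule.span ℝ (Set.range f))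
    (a : Fin M → EuclideanSpace ℝ (Fin D)) (m : Fin N → Fin M)
    (h : ∑ i : Fin M, min (anchorCount m i) K < K * (D + 1)) (t : Fin N → I) :
    ∃ (Δ : Matrix (Fin D) (Fin K) ℝ) (L : Matrix (Fin K) (Fin K) ℝ), Δ ≠ 0 ∧
      ∀ n, (a (m n)).ofLp ⬝ᵥ (Δ *ᵥ featureVec f (t n)) -
        (1 / 2) * (featureVec f (t n) ⬝ᵥ (L *ᵥ featureVec f (t n))) = 0 := by
  obtain ⟨γ, hγ⟩ := (Submodule.mem_span_range_iff_exists_fun ℝ).1 hone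
  have hγ' : ∀ x, featureVec f x ⬝ᵥ γ = 1 := by
    intro x
    have := congrFun hγ x
    simpa [dotProduct, featureVec, mul_comm] using this
  obtain ⟨Δ, c, hne, hsol⟩ := exists_ne_zero_anchor_solution m (fun i => (a i).ofLp)
    (fun n => featureVec f (t n)) h
  by_cases hΔ : Δ = 0
  · have hc : c ≠ 0 := hne.resolve_left (not_not.2 hΔ)
    -- Here `c` itself annihilates every sampled feature vector, so it can serve as each row of the
    -- trajectory part; `1 ≤ D` ensures that there is a row.
    refine ⟨Matrix.of fun _ => c, 0, fun h0 => hc (congrFun h0 ⟨0, hD⟩), fun n => ?_⟩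
    have hcn : c ⬝ᵥ featureVec f (t n) = 0 := by simpa [hΔ] using hsol n
    have : (Matrix.of fun _ : Fin D => c) *ᵥ featureVec f (t n) = 0 := funext fun _ => hcn
    simp [this]
  -- Since `fᵀ γ = 1`, the linear form `cᵀ f` equals the quadratic form `fᵀ (γ cᵀ) f`; the factor
  -- `-2` cancels `-1/2`.
  · refine ⟨Δ, (-2 : ℝ) • Matrix.vecMulVec γ c, hΔ, fun n => ?_⟩
    rw [← hsol n, Matrix.smul_mulVec, Matrix.vecMulVec_mulVec, dotProduct_smul]
    simp [hγ']

end

end ContinuousLocalisation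

/-! ### Assembly of the two halves -/

open ContinuousLocalisation

theorem mainTheorem4 {D K M N : ℕ} (hD : 1 ≤ D)
    -- the time interval and a basis of the model space
    (I : Set ℝ) (hI : I.OrdConnected)
    (F : Submodule ℝ (I → ℝ)) (hF : ContinuousLocalisation.IsModelSpace I K F)
    (f : Fin K → I → ℝ) (hf : LinearIndependent ℝ f)
    (hspan : Submodule.span ℝ (Set.range f) = F)
    -- the anchors, any `D + 1` of which are affinely independent, and their use
    (a : Fin M → EuclideanSpace ℝ (Fin D))
    (ha : ∀ s : Fin (D + 1) ↪ Fin M, AffineIndependent ℝ fun i => a (s i))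
    (m : Fin N → Fin M) :
    -- sufficiency, for random times with an absolutely continuous joint law
    (K * (D + 2) - 1 ≤ N →
      K * (D + 1) ≤ ∑ i : Fin M, min (ContinuousLocalisation.anchorCount m i) K →
      ∀ {Ω : Type*} [MeasurableSpace Ω] (P : MeasureTheory.Measure Ω)
        [MeasureTheory.IsProbabilityMeasure P] (T : Fin N → Ω → I),
        (∀ n, Measurable (T n)) →
        (P.map fun ω n => (T n ω : ℝ)).AbsolutelyContinuous
          (MeasureTheory.volume : MeasureTheory.Measure (Fin N → ℝ)) →
        ∀ᵐ ω ∂P, ∀ C : Matrix (Fin D) (Fin K) ℝ,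
          {C' : Matrix (Fin D) (Fin K) ℝ |
            ∀ n, ContinuousLocalisation.rangeMeasurement a m f (fun n => T n ω) C' n =
              ContinuousLocalisation.rangeMeasurement a m f (fun n => T n ω) C n} = {C} ∧
          {C' : Matrix (Fin D) (Fin K) ℝ | ∃ L : Matrix (Fin K) (Fin K) ℝ,
            ContinuousLocalisation.SolvesLinearized a m f (fun n => T n ω)
              (ContinuousLocalisation.linearData a m
                (ContinuousLocalisation.rangeMeasurement a m f (fun n => T n ω) C)) C' L}
            = {C}) ∧
    -- necessity, for all times
    (¬ K * (D + 1) ≤ ∑ i : Fin M, min (ContinuousLocalisation.anchorCount m i) K →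
      ∀ (t : Fin N → I) (C : Matrix (Fin D) (Fin K) ℝ),
        ∃ C' : Matrix (Fin D) (Fin K) ℝ, C' ≠ C ∧ ∃ L : Matrix (Fin K) (Fin K) ℝ,
          ContinuousLocalisation.SolvesLinearized a m f t
            (ContinuousLocalisation.linearData a m
              (ContinuousLocalisation.rangeMeasurement a m f t C)) C' L) := by
  refine ⟨fun hN hm Ω _ P _ T hT hac => ?_, fun hm t C => ?_⟩
  · have hmeas : Measurable fun ω n => (T n ω : ℝ) :=
      measurable_pi_lambda _ fun n => measurable_subtype_coe.comp (hT n)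
    have hae := MeasureTheory.ae_of_ae_map hmeas.aemeasurable
      (hac.ae_le (hF.ae_homogeneous_solution_eq_zero hf hspan ha hN hm))
    filter_upwards [hae] with ω hω C
    have hlin : ∀ C' L, SolvesLinearized a m f (fun n => T n ω)
        (linearData a m (rangeMeasurement a m f (fun n => T n ω) C)) C' L → C' = C :=
      fun C' L h => sub_eq_zero.1
        (hω (fun n => T n ω) rfl _ _ ((solvesLinearized_linearData_iff a m f _ C C' L).1 h))
    refine ⟨Set.eq_singleton_iff_unique_mem.2 ⟨fun n => rfl, fun C' hC' => ?_⟩,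
      Set.eq_singleton_iff_unique_mem.2
        ⟨⟨_, solvesLinearized_self a m f _ C⟩, fun C' ⟨L, hL⟩ => hlin C' L hL⟩⟩
    -- A matrix giving the same distances gives the same data, so with its own Gram matrix it solves
    -- the same linear system.
    refine hlin C' (C'.transpose * C') ?_
    rw [← funext hC']
    exact solvesLinearized_self a m f _ C'
  · have hK : 0 < K := by
      rcases Nat.eq_zero_or_pos K with rfl | hK
      · simp at hm
      · exact hK
    obtain ⟨Δ, L, hΔ, hsol⟩ := exists_ne_zero_homogeneous_solution hD
      (hspan ▸ hF.one_mem hK) a m (not_le.1 hm) t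
    refine ⟨C + Δ, by simpa using hΔ, L + C.transpose * C, ?_⟩
    rw [solvesLinearized_linearData_iff]
    simpa using hsol
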